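/- A polyhedron in $\mathbb{R}^d$ is a set of the form $\{x\in\mathbb{R}^d : Ax\le b\}$ with finitely many inequalities; a polytope is a nonempty bounded polyhedron. A face of a polytope $Q$ is the set of maximizers over $Q$ of a linear function, and a facet is a face of dimension $\dim Q-1$, where the dimension is that of the affine hull; $h(Q)$ denotes the number of facets of $Q$. The extension complexity of a polytope $P\subseteq\mathbb{R}^d$ is $$\mathrm{xc}(P)=\min\{h(Q) : Q\subseteq\mathbb{R}^e \text{ a polytope},\ e\ge d,\ \pi(Q)=P \text{ for some affine map } \pi:\mathbb{R}^e\to\mathbb{R}^d\},$$ and its virtual extension complexity is $$\mathrm{vxc}(P)=\min\{\mathrm{xc}(Q)+\mathrm{xc}(R) : Q,R\subseteq\mathbb{R}^d \text{ polytopes with } P+Q=R\},$$ where $P+Q$ is the Minkowski sum. The support function of $P$ is $f_P:\mathbb{R}^d\to\mathbb{R}$, $f_P(c)=\max_{x\in P}c^\top x$. A rank-$2$ maxout network with $d$ inputs is a finite directed acyclic graph whose nodes of in-degree zero are exactly $d$ input neurons; the other nodes are called maxout units, and exactly one of them, the output neuron, has out-degree zero. Each arc $(u,v)$ carries two real weights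 $w^1_{uv},w^2_{uv}$. On input $x\in\mathbb{R}^d$ the $i$-th input neuron has value $x_i$, and each maxout unit $v$ has value $z_v=\max_{i\in\{1,2\}}\sum_{u} w^i_{uv}z_u$, the sum being over the in-neighbors $u$ of $v$. The network represents the function $\mathbb{R}^d\to\mathbb{R}$ that maps $x$ to the value of the output neuron, and its size is the number of maxout units. The neural network complexity $\mathrm{nnc}(P)$ is the minimum size of a rank-$2$ maxout network that represents $f_P$. **Theorem.** For every polytope $P$, $\mathrm{vxc}(P)\le 4\cdot\mathrm{nnc}(P)$. -/

import Mathlib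

open scoped Pointwise

noncomputable section

/-! ### Polyhedra and polytopes in `ℝ^d` -/

/-- A polyhedron: a finite intersection of halfspaces `{x | A x ≤ b}`. -/
def IsPolyhedron {d : ℕ} (P : Set (Fin d → ℝ)) : Prop :=
  ∃ (m : ℕ) (A : Matrix (Fin m) (Fin d) ℝ) (b : Fin m → ℝ), P = {x | A.mulVec x ≤ b}

/-- A polytope: a bounded polyhedron. Polytopes are nonempty, so that the support function is
defined and Minkowski addition of polytopes is cancellative. -/
structure IsPolytope {d : ℕ} (P : Set (Fin d → ℝ)) : Prop where
  isPolyhedron : IsPolyhedron P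
  isBounded : Bornology.IsBounded P
  nonempty : P.Nonempty

/-- The dimension of the affine hull of `P` (only used for nonempty `P`). -/
def polyDim {d : ℕ} (P : Set (Fin d → ℝ)) : ℕ :=
  Module.finrank ℝ (affineSpan ℝ P).direction

/-- A face of `P`: the set of maximizers over `P` of a linear objective function. -/
def IsFace {d : ℕ} (P F : Set (Fin d → ℝ)) : Prop :=
  ∃ c : Fin d → ℝ, F = {x | x ∈ P ∧ ∀ y ∈ P, c ⬝ᵥ y ≤ c ⬝ᵥ x}

/-- A facet of `P`: a face of dimension `dim P - 1`. (The empty set has dimension `-1` and is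
never a facet of a polytope, since faces of a polytope are nonempty.) -/
def IsFacet {d : ℕ} (P F : Set (Fin d → ℝ)) : Prop :=
  IsFace P F ∧ F.Nonempty ∧ polyDim F + 1 = polyDim P

/-- The number of facets of `P`. -/
def numFacets {d : ℕ} (P : Set (Fin d → ℝ)) : ℕ∞ :=
  {F : Set (Fin d → ℝ) | IsFacet P F}.encard

/-- `Q ⊆ ℝ^e`, together with the affine map `π : ℝ^e → ℝ^d`, is an extended formulation of
`P ⊆ ℝ^d`. -/
def IsExtendedFormulation {d e : ℕ} (P : Set (Fin d → ℝ)) (Q : Set (Fin e → ℝ))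
    (π : (Fin e → ℝ) →ᵃ[ℝ] (Fin d → ℝ)) : Prop :=
  d ≤ e ∧ IsPolytope Q ∧ π '' Q = P

/-- Extension complexity: the minimum number of facets of an extended formulation of `P`. -/
def xc {d : ℕ} (P : Set (Fin d → ℝ)) : ℕ∞ :=
  ⨅ (e : ℕ) (Q : Set (Fin e → ℝ)) (π : (Fin e → ℝ) →ᵃ[ℝ] (Fin d → ℝ))
    (_ : IsExtendedFormulation P Q π), numFacets Q

/-- Virtual extension complexity: the minimum of `xc Q + xc R` over polytopes `Q`, `R` whose
formal Minkowski difference is `P`, i.e. `P + Q = R`. -/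
def vxc {d : ℕ} (P : Set (Fin d → ℝ)) : ℕ∞ :=
  ⨅ (Q : Set (Fin d → ℝ)) (R : Set (Fin d → ℝ))
    (_ : IsPolytope Q ∧ IsPolytope R ∧ P + Q = R), xc Q + xc R

/-- The support function `c ↦ max_{x ∈ P} cᵀx` of a polytope. -/
def supportFn {d : ℕ} (P : Set (Fin d → ℝ)) (c : Fin d → ℝ) : ℝ :=
  sSup ((fun x => c ⬝ᵥ x) '' P)

/-! ### Maxout networks -/

/-- A maxout network of rank `k` with `d` input neurons and `s` maxout units. The node set is
`Fin d ⊕ Fin s`: input neurons on the left, maxout units on the right. -/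
structure MaxoutNetwork (k d s : ℕ) where
  /-- The arcs of the underlying directed graph. -/
  Arc : Fin d ⊕ Fin s → Fin d ⊕ Fin s → Prop
  /-- The graph is acyclic. -/
  acyclic : ∀ v, ¬ Relation.TransGen Arc v v
  /-- The input neurons are exactly the neurons with in-degree zero. -/
  inDegree_zero : ∀ v, (∀ u, ¬ Arc u v) ↔ ∃ i : Fin d, v = Sum.inl i
  /-- The output neuron. -/
  output : Fin s
  /-- The output neuron is the only maxout unit with out-degree zero. -/
  outDegree_zero : ∀ v : Fin s, (∀ u, ¬ Arc (Sum.inr v) u) ↔ v = output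
  /-- `weight i u v` is the `i`-th weight of the arc from `u` to `v`; the values at pairs that
  are not arcs are irrelevant. -/
  weight : Fin k → Fin d ⊕ Fin s → Fin d ⊕ Fin s → ℝ

namespace MaxoutNetwork

variable {k d s : ℕ} (N : MaxoutNetwork k d s)

theorem wellFounded_arc : WellFounded N.Arc := by
  have h : WellFounded (Relation.TransGen N.Arc) := by
    have : Std.Irrefl (Relation.TransGen N.Arc) := ⟨N.acyclic⟩
    exact Finite.wellFounded_of_trans_of_irrefl _
  exact Subrelation.wf (fun h => Relation.TransGen.single h) h

open Classical in
/-- The output `z_v(x)` of each neuron `v` on input `x`, by recursion along the acyclic graph: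
input neurons return the coordinates of `x`, and a maxout unit returns the maximum over
`i = 1, …, k` of the `i`-th weighted sum of the outputs of its in-neighbors. -/
def value (x : Fin d → ℝ) : Fin d ⊕ Fin s → ℝ :=
  N.wellFounded_arc.fix fun v z =>
    match v, z with
    | Sum.inl i, _ => x i
    | Sum.inr v, z => ⨆ i : Fin k, ∑ u : {u // N.Arc u (Sum.inr v)},
        N.weight i u (Sum.inr v) * z u u.2

theorem value_inl (x : Fin d → ℝ) (i : Fin d) : N.value x (Sum.inl i) = x i := by
  rw [value, WellFounded.fix_eq]

open Classical in
theorem value_inr (x : Fin d → ℝ) (v : Fin s) :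
    N.value x (Sum.inr v) = ⨆ i : Fin k, ∑ u : {u // N.Arc u (Sum.inr v)},
      N.weight i u (Sum.inr v) * N.value x u := by
  rw [value, WellFounded.fix_eq]

/-- The function `ℝ^d → ℝ` represented by the network. -/
def toFun (x : Fin d → ℝ) : ℝ := N.value x (Sum.inr N.output)

end MaxoutNetwork

/-- Neural network complexity: the minimum number of maxout units of a rank-2 maxout network
that represents the support function of `P`. -/
def nnc {d : ℕ} (P : Set (Fin d → ℝ)) : ℕ∞ :=
  ⨅ (s : ℕ) (N : MaxoutNetwork 2 d s) (_ : N.toFun = supportFn P), (s : ℕ∞)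

end

/-!
On input `x`, the values `z` of the maxout units solve a max-linear system: each `z v` is the
maximum over `i` of an affine function of the other values. Acyclicity allows a substitution
`z = p - M p`, with `M` nonnegative, after which `p` solves a max-linear system with nonnegative
weights only. Such a `p` is the least solution of the corresponding linear inequalities, so linear
programming duality writes each monotone functional of `p` as a maximum over the flows that obey a
conservation law at every node. These flows form a polytope that does not depend on `x`, cut out of
a flat by one nonnegativity constraint for each pair of a unit and a rank index, hence with at most
`k * s` facets. The flow objective is linear in `x`, so the functional is the support function of a
linear image of the flow polytope. Reading `p` and `M p` at the output gives polytopes `R` and `Q`,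
each of extension complexity at most `k * s`, with `f_P = f_R - f_Q`, that is, `P + Q = R`.
-/

open scoped Topology Matrix

/-! ### Polyhedral sets -/

/-- Coordinate-free polyhedra: solution sets of finitely many weak linear inequalities in a real
vector space. On `Fin d → ℝ` this is `IsPolyhedron`; the general notion lets spaces of flows and
graphs of linear maps be handled without choosing coordinates. -/
def IsPolyhedral {E : Type*} [AddCommGroup E] [Module ℝ E] (P : Set E) : Prop :=
  ∃ (n : ℕ) (l : Fin n → Module.Dual ℝ E) (b : Fin n → ℝ), P = {x | ∀ i, l i x ≤ b i}

theorem exists_mem_upperBounds_inter_lowerBounds {α : Type*} [LinearOrder α] [Nonempty α]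
    {s t : Set α} (hs : s.Finite) (ht : t.Finite) (hst : ∀ a ∈ s, ∀ b ∈ t, a ≤ b) :
    (upperBounds s ∩ lowerBounds t).Nonempty := by
  rcases s.eq_empty_or_nonempty with rfl | hne
  · obtain ⟨c, hc⟩ := ht.bddBelow
    exact ⟨c, by simp, hc⟩
  · obtain ⟨a, ha, hmax⟩ := Set.exists_max_image s id hs hne
    exact ⟨a, hmax, hst a ha⟩

theorem exists_forall_mul_le_iff {ι K : Type*} [Finite ι] [Field K] [LinearOrder K]
    [IsStrictOrderedRing K] {β γ : ι → K} :
    (∃ t, ∀ i, β i * t ≤ γ i) ↔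
      (∀ i, β i = 0 → 0 ≤ γ i) ∧ ∀ i j, 0 < β i → β j < 0 → β j * γ i ≤ β i * γ j := by
  constructor
  · rintro ⟨t, ht⟩
    refine ⟨fun i hi => by simpa [hi] using ht i, fun i j hi hj => ?_⟩
    calc β j * γ i ≤ β j * (β i * t) := mul_le_mul_of_nonpos_left (ht i) hj.le
      _ = β i * (β j * t) := by ring
      _ ≤ β i * γ j := mul_le_mul_of_nonneg_left (ht j) hi.le
  · rintro ⟨hzero, hcross⟩
    have hsep : ∀ a ∈ (fun j => γ j / β j) '' {j | β j < 0},
        ∀ b ∈ (fun i => γ i / β i) '' {i | 0 < β i}, a ≤ b := by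
      rintro _ ⟨j, hj, rfl⟩ _ ⟨i, hi, rfl⟩
      rw [div_le_iff_of_neg hj, div_mul_eq_mul_div, div_le_iff₀ hi]
      linarith [hcross i j hi hj]
    obtain ⟨t, hlower, hupper⟩ :=
      exists_mem_upperBounds_inter_lowerBounds (Set.toFinite _) (Set.toFinite _) hsep
    refine ⟨t, fun i => ?_⟩
    rcases lt_trichotomy (β i) 0 with hi | hi | hi
    · exact (div_le_iff_of_neg' hi).1 (hlower ⟨i, hi, rfl⟩)
    · simpa [hi] using hzero i hi
    · exact (le_div_iff₀' hi).1 (hupper ⟨i, hi, rfl⟩)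

section Polyhedral

variable {E F : Type*} [AddCommGroup E] [Module ℝ E] [AddCommGroup F] [Module ℝ F]
  {P Q : Set E}

theorem isPolyhedral_setOf_forall_le {ι : Type*} [Finite ι] (l : ι → Module.Dual ℝ E)
    (b : ι → ℝ) : IsPolyhedral {x | ∀ i, l i x ≤ b i} := by
  obtain ⟨n, ⟨e⟩⟩ := Finite.exists_equiv_fin ι
  refine ⟨n, l ∘ e.symm, b ∘ e.symm, Set.ext fun x => ?_⟩
  exact (e.symm.forall_congr_right (q := fun i => l i x ≤ b i)).symm

theorem IsPolyhedral.inter (hP : IsPolyhedral P) (hQ : IsPolyhedral Q) :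
    IsPolyhedral (P ∩ Q) := by
  obtain ⟨m, l, b, rfl⟩ := hP
  obtain ⟨n, l', b', rfl⟩ := hQ
  convert isPolyhedral_setOf_forall_le (Sum.elim l l') (Sum.elim b b') using 1
  ext x
  simp [Sum.forall]

theorem IsPolyhedral.preimage {P : Set F} (hP : IsPolyhedral P) (f : E →ₗ[ℝ] F) :
    IsPolyhedral (f ⁻¹' P) := by
  obtain ⟨n, l, b, rfl⟩ := hP
  exact ⟨n, fun i => l i ∘ₗ f, b, rfl⟩

theorem isPolyhedral_singleton [FiniteDimensional ℝ E] (a : E) :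
    IsPolyhedral ({a} : Set E) := by
  let e := Module.finBasis ℝ E
  have hupper := isPolyhedral_setOf_forall_le e.coord fun i => e.coord i a
  have hlower := isPolyhedral_setOf_forall_le (fun i => -e.coord i) fun i => -e.coord i a
  convert hupper.inter hlower using 1
  ext x
  simp only [Set.mem_singleton_iff, Set.mem_inter_iff, Set.mem_ofPred_eq, LinearMap.neg_apply,
    neg_le_neg_iff, ← forall_and, ← le_antisymm_iff]
  exact e.ext_elem_iff

/-- Fourier–Motzkin elimination of the coordinate along `v`. -/
theorem IsPolyhedral.add_span_singleton (hP : IsPolyhedral P) (v : E) :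
    IsPolyhedral (P + (ℝ ∙ v : Set E)) := by
  obtain ⟨n, l, b, rfl⟩ := hP
  have hzero := isPolyhedral_setOf_forall_le (fun i : {i // l i v = 0} => l i) fun i => b i
  have hcross := isPolyhedral_setOf_forall_le
    (fun q : {i // 0 < l i v} × {j // l j v < 0} => l q.1 v • l q.2 - l q.2 v • l q.1)
    fun q => l q.1 v * b q.2 - l q.2 v * b q.1
  convert hzero.inter hcross using 1
  ext x
  have helim : x ∈ {x | ∀ i, l i x ≤ b i} + (ℝ ∙ v : Set E) ↔
      ∃ t : ℝ, ∀ i, l i v * t ≤ b i - l i x := by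
    simp only [Set.mem_add, SetLike.mem_coe, Submodule.mem_span_singleton]
    constructor
    · rintro ⟨y, hy, _, ⟨t, rfl⟩, rfl⟩
      exact ⟨-t, fun i => by simpa [mul_comm] using hy i⟩
    · rintro ⟨t, ht⟩
      refine ⟨x + t • v, fun i => ?_, _, ⟨-t, rfl⟩, by simp⟩
      simpa [mul_comm, le_sub_iff_add_le'] using ht i
  rw [helim, exists_forall_mul_le_iff]
  simp only [Set.mem_inter_iff, Set.mem_ofPred_eq, Subtype.forall, Prod.forall, sub_nonneg,
    LinearMap.sub_apply, LinearMap.smul_apply, smul_eq_mul]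
  refine and_congr_right fun _ => ⟨fun h i hi j hj => ?_, fun h i j hi hj => ?_⟩
  · linarith [h i j hi hj]
  · linarith [h i hi j hj]

theorem IsPolyhedral.add_submodule {W : Submodule ℝ E} (hW : W.FG) (hP : IsPolyhedral P) :
    IsPolyhedral (P + (W : Set E)) := by
  induction W, hW using Submodule.fg_induction generalizing P with
  | singleton v => exact hP.add_span_singleton v
  | sup W₁ W₂ _ _ ih₁ ih₂ =>
    rw [Submodule.coe_sup, ← add_assoc]
    exact ih₂ (ih₁ hP)

theorem IsPolyhedral.image [FiniteDimensional ℝ E] [FiniteDimensional ℝ F]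
    (hP : IsPolyhedral P) (f : E →ₗ[ℝ] F) : IsPolyhedral (f '' P) := by
  obtain ⟨g, hg⟩ : ∃ g : F →ₗ[ℝ] E, ∀ x, f (g (f x)) = f x := by
    obtain ⟨s, hs⟩ := f.rangeRestrict.exists_rightInverse_of_surjective f.range_rangeRestrict
    obtain ⟨g, hg⟩ := s.exists_extend
    refine ⟨g, fun x => ?_⟩
    have hgs : g (f x) = s (f.rangeRestrict x) := LinearMap.congr_fun hg (f.rangeRestrict x)
    have hfs := congrArg Subtype.val (LinearMap.congr_fun hs (f.rangeRestrict x))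
    rw [hgs]
    exact hfs
  convert ((isPolyhedral_singleton 0).preimage (f ∘ₗ g - LinearMap.id)).inter
    ((hP.add_submodule (IsNoetherian.noetherian f.ker)).preimage g) using 1
  ext y
  simp only [Set.mem_inter_iff, Set.mem_preimage, Set.mem_singleton_iff, LinearMap.sub_apply,
    LinearMap.comp_apply, LinearMap.id_apply, sub_eq_zero, Set.mem_add, SetLike.mem_coe,
    LinearMap.mem_ker]
  constructor
  · rintro ⟨x, hx, rfl⟩
    exact ⟨hg x, x, hx, g (f x) - x, by simp [hg], by simp⟩
  · rintro ⟨hy, x, hx, z, hz, hxz⟩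
    exact ⟨x, hx, by rw [← hy, ← hxz, map_add, hz, add_zero]⟩

end Polyhedral

theorem isPolyhedron_iff_isPolyhedral {d : ℕ} {P : Set (Fin d → ℝ)} :
    IsPolyhedron P ↔ IsPolyhedral P := by
  constructor
  · rintro ⟨m, A, b, rfl⟩
    exact ⟨m, fun i => LinearMap.proj i ∘ₗ A.mulVecLin, b, rfl⟩
  · rintro ⟨m, l, b, rfl⟩
    refine ⟨m, LinearMap.toMatrix' (LinearMap.pi l), b, Set.ext fun x => ?_⟩
    rw [Set.mem_ofPred_eq, Set.mem_ofPred_eq, LinearMap.toMatrix'_mulVec, Pi.le_def]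
    rfl

theorem IsPolyhedron.isClosed {d : ℕ} {P : Set (Fin d → ℝ)} (hP : IsPolyhedron P) :
    IsClosed P := by
  obtain ⟨m, A, b, rfl⟩ := hP
  exact isClosed_le (by fun_prop) continuous_const

theorem IsPolyhedron.convex {d : ℕ} {P : Set (Fin d → ℝ)} (hP : IsPolyhedron P) :
    Convex ℝ P := by
  obtain ⟨m, A, b, rfl⟩ := hP
  exact (convex_Iic b).linear_preimage A.mulVecLin

theorem IsPolytope.isCompact {d : ℕ} {P : Set (Fin d → ℝ)} (hP : IsPolytope P) :
    IsCompact P :=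
  Metric.isCompact_of_isClosed_isBounded hP.isPolyhedron.isClosed hP.isBounded

theorem IsPolyhedral.isPolytope {d : ℕ} {P : Set (Fin d → ℝ)} (hP : IsPolyhedral P)
    (hcompact : IsCompact P) (hne : P.Nonempty) : IsPolytope P :=
  ⟨isPolyhedron_iff_isPolyhedral.2 hP, hcompact.isBounded, hne⟩

/-! ### Facets -/

section Facets

variable {E κ : Type*} [AddCommGroup E] [Module ℝ E]

/-- The polyhedron cut out of the flat `S` by the inequalities `0 ≤ l i x`. Separating the
equations (the flat) from the inequalities is what lets facets be counted by inequalities only. -/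
def flatPolyhedron (S : AffineSubspace ℝ E) (l : κ → Module.Dual ℝ E) : Set E :=
  {x | x ∈ S ∧ ∀ i, 0 ≤ l i x}

variable {S : AffineSubspace ℝ E} {l : κ → Module.Dual ℝ E} {F : Set E}

theorem convex_flatPolyhedron : Convex ℝ (flatPolyhedron S l) := by
  rintro x ⟨hxS, hx⟩ y ⟨hyS, hy⟩ a b ha hb hab
  refine ⟨S.convex hxS hyS ha hb hab, fun i => ?_⟩
  rw [map_add, map_smul, map_smul]
  exact add_nonneg (smul_nonneg ha (hx i)) (smul_nonneg hb (hy i))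

theorem exists_mem_forall_eq_zero_or_pos [Finite κ] (hF : Convex ℝ F) (hne : F.Nonempty)
    (hnonneg : ∀ x ∈ F, ∀ i, 0 ≤ l i x) :
    ∃ p ∈ F, ∀ i, (∀ x ∈ F, l i x = 0) ∨ 0 < l i p := by
  classical
  have := Fintype.ofFinite κ
  suffices ∀ s : Finset κ, ∃ p ∈ F, ∀ i ∈ s, (∀ x ∈ F, l i x = 0) ∨ 0 < l i p by
    simpa using this Finset.univ
  intro s
  induction s using Finset.induction_on with
  | empty => exact hne.imp fun p hp => ⟨hp, by simp⟩
  | insert j s _ ih =>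
    obtain ⟨p, hp, hps⟩ := ih
    by_cases hj : ∀ x ∈ F, l j x = 0
    · exact ⟨p, hp, Finset.forall_mem_insert _ _ _ |>.2 ⟨Or.inl hj, hps⟩⟩
    push Not at hj
    obtain ⟨q, hq, hqj⟩ := hj
    have hadd (i : κ) : l i (midpoint ℝ p q) = 2⁻¹ * (l i p + l i q) := by
      simp [midpoint_eq_smul_add, mul_add]
    refine ⟨midpoint ℝ p q, hF.midpoint_mem hp hq, fun i hi => ?_⟩
    rcases Finset.mem_insert.1 hi with rfl | hi
    · have := (hnonneg q hq i).lt_of_ne' hqj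
      exact Or.inr (by linarith [hadd i, hnonneg p hp i])
    · exact (hps i hi).imp_right fun hpos => by linarith [hadd i, hnonneg q hq i]

theorem exists_pos_add_smul_sub_mem_flatPolyhedron [Finite κ] {p q : E}
    (hp : p ∈ flatPolyhedron S l) (hq : q ∈ flatPolyhedron S l)
    (htight : ∀ i, l i p = 0 → l i q = 0) :
    ∃ ε : ℝ, 0 < ε ∧ p + ε • (p - q) ∈ flatPolyhedron S l := by
  have hflat (ε : ℝ) : p + ε • (p - q) ∈ S := by
    simpa [AffineMap.lineMap_apply, add_comm] using
      S.smul_vsub_vadd_mem ε hp.1 hq.1 hp.1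
  have hineq : ∀ᶠ ε in 𝓝[>] (0 : ℝ), ∀ i, 0 ≤ l i (p + ε • (p - q)) := by
    refine Filter.eventually_all.2 fun i => ?_
    simp only [map_add, map_smul, map_sub, smul_eq_mul]
    rcases (hp.2 i).eq_or_lt' with hzero | hpos
    · simp [hzero, htight i hzero]
    · have hcont : Continuous fun ε : ℝ => l i p + ε * (l i p - l i q) := by fun_prop
      refine (hcont.tendsto 0).eventually (lt_mem_nhds (by simpa using hpos))
        |>.filter_mono nhdsWithin_le_nhds |>.mono fun ε hε => hε.le
  obtain ⟨ε, hε, hpos⟩ := (hineq.and self_mem_nhdsWithin).exists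
  exact ⟨ε, hpos, hflat ε, hε⟩

theorem exists_tight_of_isExtreme_flatPolyhedron [Finite κ]
    (hF : IsExtreme ℝ (flatPolyhedron S l) F) (hconv : Convex ℝ F) (hne : F.Nonempty)
    (hproper : F ≠ flatPolyhedron S l) :
    ∃ i, (∀ x ∈ F, l i x = 0) ∧ ∃ x ∈ flatPolyhedron S l, l i x ≠ 0 := by
  by_contra! htight
  obtain ⟨p, hp, hpF⟩ :=
    exists_mem_forall_eq_zero_or_pos hconv hne fun x hx i => (hF.subset hx).2 i
  refine hproper (hF.subset.antisymm fun q hq => ?_)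
  obtain ⟨ε, hε, hr⟩ :=
    exists_pos_add_smul_sub_mem_flatPolyhedron (hF.subset hp) hq fun i hi =>
      htight i ((hpF i).resolve_right (by simp [hi])) q hq
  refine hF.left_mem_of_mem_openSegment hq hr hp
    ⟨ε / (1 + ε), 1 / (1 + ε), by positivity, by positivity, by field_simp; ring, ?_⟩
  match_scalars <;> field_simp
  ring

end Facets

theorem inter_affineSpan_subset_of_isExposed {E : Type*} [AddCommGroup E] [Module ℝ E]
    [TopologicalSpace E] {A F : Set E} (hF : IsExposed ℝ A F) (hne : F.Nonempty) :
    A ∩ affineSpan ℝ F ⊆ F := by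
  obtain ⟨f, rfl⟩ := hF hne
  obtain ⟨p, hpA, hp⟩ := hne
  rintro x ⟨hxA, hx⟩
  have hlevel : affineSpan ℝ {x ∈ A | ∀ y ∈ A, f y ≤ f x} ≤ AffineSubspace.mk' p f.ker := by
    refine affineSpan_le.2 fun y hy => ?_
    rw [SetLike.mem_coe, AffineSubspace.mem_mk', LinearMap.mem_ker, vsub_eq_sub, map_sub,
      sub_eq_zero]
    exact (hp y hy.1).antisymm (hy.2 p hpA)
  have hxp : f x = f p := by
    have := hlevel hx
    rwa [AffineSubspace.mem_mk', LinearMap.mem_ker, vsub_eq_sub, map_sub, sub_eq_zero] at this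
  exact ⟨hxA, fun y hy => hxp ▸ hp y hy⟩

theorem exists_eq_setOf_eq_zero_of_isExposed_flatPolyhedron {E κ : Type*} [AddCommGroup E]
    [Module ℝ E] [TopologicalSpace E] [FiniteDimensional ℝ E] [Finite κ]
    {S : AffineSubspace ℝ E} {l : κ → Module.Dual ℝ E} {F : Set E}
    (hF : IsExposed ℝ (flatPolyhedron S l) F) (hne : F.Nonempty)
    (hdim : Module.finrank ℝ (vectorSpan ℝ F) + 1 =
      Module.finrank ℝ (vectorSpan ℝ (flatPolyhedron S l))) :
    ∃ i, F = {x ∈ flatPolyhedron S l | l i x = 0} := by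
  obtain ⟨i, hi, x, hx, hix⟩ := exists_tight_of_isExtreme_flatPolyhedron hF.isExtreme
    (hF.convex convex_flatPolyhedron) hne fun h => by rw [h] at hdim; omega
  set Q := flatPolyhedron S l
  set G := {x ∈ Q | l i x = 0}
  obtain ⟨p, hp⟩ := hne
  have hFG : F ⊆ G := fun y hy => ⟨hF.subset hy, hi y hy⟩
  have hG : vectorSpan ℝ G ≤ (l i).ker := by
    refine Submodule.span_le.2 ?_
    rintro _ ⟨y, hy, z, hz, rfl⟩
    simp [hy.2, hz.2]
  have hlt : vectorSpan ℝ G < vectorSpan ℝ Q := by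
    refine (vectorSpan_mono ℝ (Set.sep_subset _ _)).lt_of_not_ge fun hle => hix ?_
    have := hG (hle (vsub_mem_vectorSpan ℝ hx (hF.subset hp)))
    simpa [hi p hp] using this
  have hdir : vectorSpan ℝ F = vectorSpan ℝ G :=
    Submodule.eq_of_le_of_finrank_le (vectorSpan_mono ℝ hFG)
      (by have := Submodule.finrank_lt_finrank_of_lt hlt; omega)
  refine ⟨i, hFG.antisymm fun y hy => inter_affineSpan_subset_of_isExposed hF ⟨p, hp⟩ ⟨hy.1, ?_⟩⟩
  rw [SetLike.mem_coe, ← AffineSubspace.vsub_right_mem_direction_iff_mem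
    (subset_affineSpan ℝ F hp), direction_affineSpan, hdir]
  exact vsub_mem_vectorSpan ℝ hy (hFG hp)

theorem IsFace.isExposed {d : ℕ} {P F : Set (Fin d → ℝ)} (hF : IsFace P F) :
    IsExposed ℝ P F := by
  obtain ⟨c, rfl⟩ := hF
  exact fun _ => ⟨(dotProductEquiv ℝ (Fin d) c).toContinuousLinearMap, rfl⟩

theorem numFacets_flatPolyhedron_le {d : ℕ} {κ : Type*} [Finite κ]
    (S : AffineSubspace ℝ (Fin d → ℝ)) (l : κ → Module.Dual ℝ (Fin d → ℝ)) :
    numFacets (flatPolyhedron S l) ≤ Nat.card κ := by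
  have hsub : {F | IsFacet (flatPolyhedron S l) F} ⊆
      Set.range fun i => {x ∈ flatPolyhedron S l | l i x = 0} := by
    rintro F ⟨hface, hne, hdim⟩
    rw [polyDim, polyDim, direction_affineSpan, direction_affineSpan] at hdim
    obtain ⟨i, rfl⟩ :=
      exists_eq_setOf_eq_zero_of_isExposed_flatPolyhedron hface.isExposed hne hdim
    exact ⟨i, rfl⟩
  calc numFacets (flatPolyhedron S l)
      ≤ (Set.range fun i => {x ∈ flatPolyhedron S l | l i x = 0}).encard :=
        Set.encard_le_encard hsub
    _ ≤ (Set.univ : Set κ).encard := by rw [← Set.image_univ]; exact Set.encard_image_le _ _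
    _ = Nat.card κ := by rw [Set.encard_univ, ENat.card_eq_coe_natCard]

/-! ### Extension complexity -/

theorem isPolyhedral_flatPolyhedron {E κ : Type*} [AddCommGroup E] [Module ℝ E]
    [FiniteDimensional ℝ E] [Finite κ] {S : AffineSubspace ℝ E} {l : κ → Module.Dual ℝ E}
    (hne : (flatPolyhedron S l).Nonempty) : IsPolyhedral (flatPolyhedron S l) := by
  obtain ⟨p, hp, -⟩ := hne
  have hflat := (isPolyhedral_singleton (S.direction.mkQ p)).preimage S.direction.mkQ
  have hineq := isPolyhedral_setOf_forall_le (fun i => -l i) 0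
  convert hflat.inter hineq using 1
  ext x
  simp [flatPolyhedron, Submodule.Quotient.eq, ← AffineSubspace.vsub_right_mem_direction_iff_mem hp]

theorem image_flatPolyhedron_of_leftInverse {E F κ : Type*} [AddCommGroup E] [Module ℝ E]
    [AddCommGroup F] [Module ℝ F] (S : AffineSubspace ℝ E) (l : κ → Module.Dual ℝ E)
    {f : E →ₗ[ℝ] F} {g : F →ₗ[ℝ] E} (hgf : Function.LeftInverse g f) :
    f '' flatPolyhedron S l = flatPolyhedron (S.map f.toAffineMap) fun i => l i ∘ₗ g := by
  ext y
  constructor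
  · rintro ⟨x, ⟨hxS, hx⟩, rfl⟩
    exact ⟨AffineSubspace.mem_map_of_mem _ hxS, fun i => by simpa [hgf x] using hx i⟩
  · rintro ⟨⟨x, hxS, rfl⟩, hx⟩
    exact ⟨x, ⟨hxS, fun i => by simpa [hgf x] using hx i⟩, rfl⟩

section ExtensionComplexity

variable {E κ : Type*} [NormedAddCommGroup E] [NormedSpace ℝ E] [FiniteDimensional ℝ E]
  [Finite κ] {d : ℕ} {S : AffineSubspace ℝ E} {l : κ → Module.Dual ℝ E}

theorem isPolytope_image_flatPolyhedron (hcompact : IsCompact (flatPolyhedron S l))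
    (hne : (flatPolyhedron S l).Nonempty) (f : E →ₗ[ℝ] (Fin d → ℝ)) :
    IsPolytope (f '' flatPolyhedron S l) :=
  ((isPolyhedral_flatPolyhedron hne).image f).isPolytope
    (hcompact.image f.continuous_of_finiteDimensional) (hne.image f)

theorem xc_image_flatPolyhedron_le (hcompact : IsCompact (flatPolyhedron S l))
    (hne : (flatPolyhedron S l).Nonempty) (f : E →ₗ[ℝ] (Fin d → ℝ)) :
    xc (f '' flatPolyhedron S l) ≤ Nat.card κ := by
  obtain ⟨J, hJ⟩ : ∃ J : E →ₗ[ℝ] (Fin (Module.finrank ℝ E + d) → ℝ), Function.Injective J :=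
    finrank_le_iff_exists_linearMap.1 (by simp)
  obtain ⟨ρ, hρ⟩ := J.exists_leftInverse_of_injective (LinearMap.ker_eq_bot.2 hJ)
  have hρJ : Function.LeftInverse ρ J := LinearMap.congr_fun hρ
  have hext : IsExtendedFormulation (f '' flatPolyhedron S l) (J '' flatPolyhedron S l)
      (f ∘ₗ ρ).toAffineMap := by
    refine ⟨Nat.le_add_left _ _, isPolytope_image_flatPolyhedron hcompact hne J, ?_⟩
    simp [Set.image_image, hρJ _]
  calc xc (f '' flatPolyhedron S l)
      ≤ numFacets (J '' flatPolyhedron S l) := iInf_le_of_le _ <| iInf_le_of_le _ <|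
        iInf_le_of_le _ <| iInf_le _ hext
    _ ≤ Nat.card κ := by
      rw [image_flatPolyhedron_of_leftInverse S l hρJ]
      exact numFacets_flatPolyhedron_le _ _

end ExtensionComplexity

/-! ### Support functions -/

section SupportFunction

variable {d : ℕ} {P Q : Set (Fin d → ℝ)}

theorem bddAbove_image_dotProduct (hP : IsCompact P) (c : Fin d → ℝ) :
    BddAbove ((fun x => c ⬝ᵥ x) '' P) :=
  (hP.image (by fun_prop)).bddAbove

theorem supportFn_add (hP : IsCompact P) (hP' : P.Nonempty) (hQ : IsCompact Q)
    (hQ' : Q.Nonempty) (c : Fin d → ℝ) :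
    supportFn (P + Q) c = supportFn P c + supportFn Q c := by
  have himage : (fun x => c ⬝ᵥ x) '' (P + Q) = (fun x => c ⬝ᵥ x) '' P + (fun x => c ⬝ᵥ x) '' Q :=
    Set.image_add (dotProductEquiv ℝ (Fin d) c)
  rw [supportFn, himage, csSup_add (hP'.image _) (bddAbove_image_dotProduct hP c) (hQ'.image _)
    (bddAbove_image_dotProduct hQ c), supportFn, supportFn]

theorem subset_of_supportFn_le (hP : IsCompact P) (hQ : IsClosed Q) (hQconv : Convex ℝ Q)
    (hQne : Q.Nonempty) (hle : supportFn P ≤ supportFn Q) : P ⊆ Q := by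
  intro x hx
  by_contra hxQ
  obtain ⟨f, u, hfQ, hfx⟩ := geometric_hahn_banach_closed_point hQconv hQ hxQ
  obtain ⟨c, hc⟩ := (dotProductEquiv ℝ (Fin d)).surjective f
  have hf (y : Fin d → ℝ) : f y = c ⬝ᵥ y := (LinearMap.congr_fun hc y).symm
  refine hfx.not_ge ?_
  calc f x = c ⬝ᵥ x := hf x
    _ ≤ supportFn P c := le_csSup (bddAbove_image_dotProduct hP c) ⟨x, hx, rfl⟩
    _ ≤ supportFn Q c := hle c
    _ ≤ u := csSup_le (hQne.image _) <| Set.forall_mem_image.2 fun y hy =>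
      (hf y).symm.trans_le (hfQ y hy).le

theorem eq_of_supportFn_eq (hP : IsCompact P) (hPconv : Convex ℝ P) (hPne : P.Nonempty)
    (hQ : IsCompact Q) (hQconv : Convex ℝ Q) (hQne : Q.Nonempty)
    (heq : supportFn P = supportFn Q) : P = Q :=
  (subset_of_supportFn_le hP hQ.isClosed hQconv hQne heq.le).antisymm
    (subset_of_supportFn_le hQ hP.isClosed hPconv hPne heq.ge)

end SupportFunction

/-! ### Strictly triangular matrices -/

section StrictlyTriangular

variable {V α R : Type*} [Fintype V]

/-- The matrices whose entry at `(v, u)` vanishes unless `b u < b v`: the weight matrices of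
layered acyclic graphs, where `b` is the layer and rows are heads of arcs. -/
def strictlyTriangular [Preorder α] [NonUnitalRing R] (b : V → α) :
    NonUnitalSubring (Matrix V V R) where
  carrier := {M | ∀ v u, M v u ≠ 0 → b u < b v}
  zero_mem' := fun _ _ h => absurd rfl h
  add_mem' := fun hM hN v u h => by
    by_contra hvu
    exact h (by simp [not_imp_comm.1 (hM v u) hvu, not_imp_comm.1 (hN v u) hvu])
  neg_mem' := fun hM v u h => hM v u (neg_ne_zero.1 h)
  mul_mem' := fun hM hN v u h => by
    obtain ⟨t, -, ht⟩ := Finset.exists_ne_zero_of_sum_ne_zero h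
    exact (hN t u (right_ne_zero_of_mul ht)).trans (hM v t (left_ne_zero_of_mul ht))

variable [Ring R] {b : V → ℕ} {M : Matrix V V R}

theorem add_le_of_pow_apply_ne_zero [DecidableEq V] (hM : M ∈ strictlyTriangular b) (n : ℕ)
    {v u : V} (h : (M ^ n) v u ≠ 0) : b u + n ≤ b v := by
  induction n generalizing v with
  | zero =>
    rcases eq_or_ne v u with rfl | hvu
    · rfl
    · simp [hvu] at h
  | succ n ih =>
    rw [pow_succ'] at h
    obtain ⟨t, -, ht⟩ := Finset.exists_ne_zero_of_sum_ne_zero h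
    have := hM v t (left_ne_zero_of_mul ht)
    have := ih (right_ne_zero_of_mul ht)
    omega

theorem isNilpotent_of_mem_strictlyTriangular [DecidableEq V]
    (hM : M ∈ strictlyTriangular b) : IsNilpotent M := by
  obtain ⟨n, hn⟩ := (Set.finite_range b).bddAbove
  refine ⟨n + 1, Matrix.ext fun v u => ?_⟩
  by_contra h
  have := add_le_of_pow_apply_ne_zero hM (n + 1) h
  have := hn ⟨v, rfl⟩
  omega

/-- `S` is the sum of all positive powers of `M`. -/
theorem exists_strictlyTriangular_eq_add_mul [PartialOrder R] [IsOrderedRing R]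
    (hM : M ∈ strictlyTriangular b) (hnonneg : ∀ v u, 0 ≤ M v u) :
    ∃ S ∈ strictlyTriangular b, (∀ v u, 0 ≤ S v u) ∧ S = M + M * S ∧ S = M + S * M := by
  classical
  obtain ⟨n, hn⟩ := isNilpotent_of_mem_strictlyTriangular hM
  have hlast : M ^ (n + 1) = 0 := by rw [pow_succ, hn, zero_mul]
  have hshift : ∑ k ∈ Finset.range n, M ^ (k + 1) =
      M + ∑ k ∈ Finset.range n, M ^ (k + 1 + 1) := by
    rw [← add_zero (∑ k ∈ Finset.range n, M ^ (k + 1)), ← hlast, ← Finset.sum_range_succ,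
      Finset.sum_range_succ', zero_add, pow_one, add_comm]
  have hpow (k : ℕ) : M ^ (k + 1) ∈ strictlyTriangular b := by
    induction k with
    | zero => simpa using hM
    | succ k ih => exact pow_succ M (k + 1) ▸ mul_mem ih hM
  refine ⟨∑ k ∈ Finset.range n, M ^ (k + 1), sum_mem fun k _ => hpow k, fun v u => ?_, ?_, ?_⟩
  · rw [Matrix.sum_apply]
    exact Finset.sum_nonneg fun k _ => Matrix.pow_apply_nonneg hnonneg (k + 1) v u
  · simp only [Finset.mul_sum, ← pow_succ']
    exact hshift
  · simp only [Finset.sum_mul, ← pow_succ]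
    exact hshift

end StrictlyTriangular

/-! ### Max-linear systems -/

section MaxSystem

variable {ι V : Type*} [Fintype V]

/-- `p` solves the system `p v = max_i (w i *ᵥ p + β i) v`. -/
def SolvesMaxSystem (w : ι → Matrix V V ℝ) (β : ι → V → ℝ) (p : V → ℝ) : Prop :=
  ∀ v, IsGreatest (Set.range fun i => (w i *ᵥ p + β i) v) (p v)

theorem SolvesMaxSystem.add {w w' : ι → Matrix V V ℝ} {β : ι → V → ℝ} {z p q : V → ℝ}
    (hz : SolvesMaxSystem w β z) (hp : p = z + q) (hw : ∀ i, w' i *ᵥ p = w i *ᵥ z + q) :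
    SolvesMaxSystem w' β p := by
  intro v
  have hrange : Set.range (fun i => (w' i *ᵥ p + β i) v) =
      (· + q v) '' Set.range fun i => (w i *ᵥ z + β i) v := by
    rw [← Set.range_comp]
    refine congrArg Set.range (funext fun i => ?_)
    simp only [hw, Pi.add_apply, Function.comp_apply]
    ring
  rw [hrange, hp]
  exact (add_left_mono (a := q v)).map_isGreatest (hz v)

/-- Take `M = ω + ω ^ 2 + ⋯` with `ω = ∑ i, |W i|`. The substitution `z = p - M p` turns the weights
`W i` into `W i + M - W i * M`, which are nonnegative because `W i * M - W i ≤ ω * M + ω = M`. -/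
theorem exists_nonneg_weights [Finite ι] {b : V → ℕ} (W : ι → Matrix V V ℝ)
    (hW : ∀ i, W i ∈ strictlyTriangular b) :
    ∃ (M : Matrix V V ℝ) (w : ι → Matrix V V ℝ), (∀ v u, 0 ≤ M v u) ∧
      (∀ i, w i ∈ strictlyTriangular b) ∧ (∀ i v u, 0 ≤ w i v u) ∧
      ∀ β z, SolvesMaxSystem W β z → ∃ p, p = z + M *ᵥ p ∧ SolvesMaxSystem w β p := by
  have := Fintype.ofFinite ι
  let ω : Matrix V V ℝ := ∑ i, (W i).map abs
  have hω_mem : ω ∈ strictlyTriangular b :=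
    sum_mem fun i _ v u h => hW i v u (abs_ne_zero.1 h)
  have hω_apply (v u : V) : ω v u = ∑ i, |W i v u| := by
    simp [ω, Matrix.sum_apply]
  have hW_le (i : ι) (v u : V) : |W i v u| ≤ ω v u := by
    rw [hω_apply]
    exact Finset.single_le_sum (f := fun i => |W i v u|) (fun _ _ => abs_nonneg _)
      (Finset.mem_univ i)
  obtain ⟨M, hM_mem, hM_nonneg, hM, -⟩ := exists_strictlyTriangular_eq_add_mul hω_mem
    fun v u => by rw [hω_apply]; positivity
  obtain ⟨S, -, -, hS, -⟩ := exists_strictlyTriangular_eq_add_mul hM_mem hM_nonneg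
  refine ⟨M, fun i => W i + M - W i * M, hM_nonneg,
    fun i => sub_mem (add_mem (hW i) hM_mem) (mul_mem (hW i) hM_mem), fun i v u => ?_,
    fun β z hz => ?_⟩
  · have hmul : (W i * M) v u ≤ (ω * M) v u := Finset.sum_le_sum fun t _ =>
      mul_le_mul_of_nonneg_right ((le_abs_self _).trans (hW_le i v t)) (hM_nonneg t u)
    have hMvu : M v u = ω v u + (ω * M) v u := congrFun (congrFun hM v) u
    have hneg : -W i v u ≤ ω v u := (neg_le_abs _).trans (hW_le i v u)
    simp only [Matrix.sub_apply, Matrix.add_apply]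
    linarith
  · have hMp : M *ᵥ (z + S *ᵥ z) = S *ᵥ z := by
      rw [Matrix.mulVec_add, Matrix.mulVec_mulVec, ← Matrix.add_mulVec, ← hS]
    refine ⟨z + S *ᵥ z, by rw [hMp], hz.add rfl fun i => ?_⟩
    rw [Matrix.sub_mulVec, Matrix.add_mulVec, ← Matrix.mulVec_mulVec, hMp, Matrix.mulVec_add]
    abel

end MaxSystem

/-! ### Flow polytopes -/

section Flow

variable {ι V : Type*} [Fintype ι] [Fintype V]

/-- What the flow `y` leaves at each node: `y i v` units are pushed through the `i`-th row of the
weights of `v`, and `w i v u` times that amount reappears at `u`. -/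
def netFlow (w : ι → Matrix V V ℝ) : (ι → V → ℝ) →ₗ[ℝ] V → ℝ :=
  ∑ i, (LinearMap.id - (w i).vecMulLinear) ∘ₗ LinearMap.proj i

theorem netFlow_apply (w : ι → Matrix V V ℝ) (y : ι → V → ℝ) :
    netFlow w y = ∑ i, (y i - y i ᵥ* w i) := by
  simp [netFlow]

/-- The nonnegative flows with prescribed net flow `l`: the feasible region of the dual of the
linear program that a max-linear system with nonnegative weights solves. -/
def flowPolytope (w : ι → Matrix V V ℝ) (l : V → ℝ) : Set (ι → V → ℝ) :=
  flatPolyhedron ((AffineSubspace.mk' l ⊥).comap (netFlow w).toAffineMap)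
    fun q : ι × V => LinearMap.proj q.2 ∘ₗ LinearMap.proj q.1

variable {w : ι → Matrix V V ℝ} {l : V → ℝ} {y : ι → V → ℝ} {b : V → ℕ}

theorem mem_flowPolytope : y ∈ flowPolytope w l ↔ netFlow w y = l ∧ 0 ≤ y := by
  simp [flowPolytope, flatPolyhedron, sub_eq_zero, Pi.le_def]

theorem netFlow_dotProduct (w : ι → Matrix V V ℝ) (y : ι → V → ℝ) (p : V → ℝ) :
    netFlow w y ⬝ᵥ p = ∑ i, y i ⬝ᵥ (p - w i *ᵥ p) := by
  simp only [netFlow_apply, sum_dotProduct, sub_dotProduct, dotProduct_sub,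
    Matrix.dotProduct_mulVec]

theorem sum_dotProduct_le_of_mem_flowPolytope {β : ι → V → ℝ} {p : V → ℝ}
    (hp : ∀ i, w i *ᵥ p + β i ≤ p) (hy : y ∈ flowPolytope w l) :
    ∑ i, y i ⬝ᵥ β i ≤ l ⬝ᵥ p := by
  obtain ⟨hnet, hy⟩ := mem_flowPolytope.1 hy
  rw [← hnet, netFlow_dotProduct]
  exact Finset.sum_le_sum fun i _ =>
    dotProduct_le_dotProduct_of_nonneg_left (le_sub_iff_add_le'.2 (hp i)) (hy i)

/-- The flow that uses only the rows selected by the policy `σ`. -/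
theorem exists_mem_flowPolytope_supported (hmem : ∀ i, w i ∈ strictlyTriangular b)
    (hnonneg : ∀ i v u, 0 ≤ w i v u) (hl : 0 ≤ l) (σ : V → ι) :
    ∃ y ∈ flowPolytope w l, ∀ i v, y i v ≠ 0 → i = σ v := by
  classical
  let wσ : Matrix V V ℝ := Matrix.of fun v => w (σ v) v
  obtain ⟨S, -, hS_nonneg, -, hS⟩ := exists_strictlyTriangular_eq_add_mul (M := wσ) (b := b)
    (fun v u h => hmem (σ v) v u h) fun v u => hnonneg (σ v) v u
  let φ : V → ℝ := l + l ᵥ* S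
  have hφ : φ = l + φ ᵥ* wσ := by
    rw [Matrix.add_vecMul, Matrix.vecMul_vecMul, ← Matrix.vecMul_add, ← hS]
  have hφ_nonneg (v : V) : 0 ≤ φ v :=
    add_nonneg (hl v) (dotProduct_nonneg_of_nonneg hl fun u => hS_nonneg u v)
  let y : ι → V → ℝ := fun i v => if i = σ v then φ v else 0
  have hsum : ∑ i, y i = φ := by
    ext v
    simp [y, Finset.sum_apply]
  have hsum_mul : ∑ i, y i ᵥ* w i = φ ᵥ* wσ := by
    ext u
    simp only [Finset.sum_apply, Matrix.vecMul, dotProduct]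
    rw [Finset.sum_comm]
    simp [y, wσ]
  refine ⟨y, mem_flowPolytope.2 ⟨?_, fun i v => ?_⟩, fun i v h => by_contra fun hi => h (if_neg hi)⟩
  · rw [netFlow_apply, Finset.sum_sub_distrib, hsum, hsum_mul, sub_eq_iff_eq_add]
    exact hφ
  · dsimp only [y]
    split_ifs
    exacts [hφ_nonneg v, le_rfl]

/-- Linear programming duality: following an optimal choice of maximizers makes every inequality
of `sum_dotProduct_le_of_mem_flowPolytope` tight. -/
theorem SolvesMaxSystem.isGreatest_image_flowPolytope {β : ι → V → ℝ} {p : V → ℝ}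
    (hp : SolvesMaxSystem w β p) (hmem : ∀ i, w i ∈ strictlyTriangular b)
    (hnonneg : ∀ i v u, 0 ≤ w i v u) (hl : 0 ≤ l) :
    IsGreatest ((fun y => ∑ i, y i ⬝ᵥ β i) '' flowPolytope w l) (l ⬝ᵥ p) := by
  constructor
  · choose σ hσ using fun v => (hp v).1
    obtain ⟨y, hy, hyσ⟩ := exists_mem_flowPolytope_supported hmem hnonneg hl σ
    refine ⟨y, hy, ?_⟩
    rw [← (mem_flowPolytope.1 hy).1, netFlow_dotProduct]
    refine Finset.sum_congr rfl fun i _ => Finset.sum_congr rfl fun v _ => ?_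
    rcases eq_or_ne (y i v) 0 with hzero | hne
    · simp [hzero]
    · obtain rfl := hyσ i v hne
      rw [Pi.sub_apply, eq_sub_of_add_eq' (hσ v)]
  · rintro _ ⟨y, hy, rfl⟩
    exact sum_dotProduct_le_of_mem_flowPolytope (fun i v => (hp v).2 ⟨i, rfl⟩) hy

theorem vecMul_mono {m n R : Type*} [Fintype m] [Semiring R] [PartialOrder R] [IsOrderedRing R]
    {A : Matrix m n R} (hA : ∀ i j, 0 ≤ A i j) : Monotone fun x : m → R => x ᵥ* A :=
  fun _ _ hxy j => dotProduct_le_dotProduct_of_nonneg_right hxy fun i => hA i j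

theorem exists_forall_mem_flowPolytope_sum_le (hmem : ∀ i, w i ∈ strictlyTriangular b)
    (hnonneg : ∀ i v u, 0 ≤ w i v u) (l : V → ℝ) :
    ∃ B : V → ℝ, ∀ y ∈ flowPolytope w l, ∑ i, y i ≤ B := by
  let ω : Matrix V V ℝ := ∑ i, w i
  have hω_apply (v u : V) : ω v u = ∑ i, w i v u := Matrix.sum_apply ..
  obtain ⟨S, -, hS_nonneg, hS, -⟩ :=
    exists_strictlyTriangular_eq_add_mul (M := ω) (sum_mem fun i _ => hmem i)
      fun v u => by rw [hω_apply]; exact Finset.sum_nonneg fun i _ => hnonneg i v u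
  refine ⟨l + l ᵥ* S, fun y hy => ?_⟩
  obtain ⟨hnet, hy⟩ := mem_flowPolytope.1 hy
  set Y := ∑ i, y i
  have hlocal : Y - Y ᵥ* ω ≤ l := by
    have hrow (i : ι) : y i ᵥ* w i ≤ Y ᵥ* w i :=
      vecMul_mono (hnonneg i) (Finset.single_le_sum (fun i _ => hy i) (Finset.mem_univ i))
    rw [← hnet, netFlow_apply, Finset.sum_sub_distrib, Matrix.vecMul_sum]
    exact sub_le_sub_left (Finset.sum_le_sum fun i _ => hrow i) _
  calc Y = (Y - Y ᵥ* ω) + (Y - Y ᵥ* ω) ᵥ* S := by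
        have hYS : Y ᵥ* S = Y ᵥ* ω + (Y ᵥ* ω) ᵥ* S := by
          rw [Matrix.vecMul_vecMul, ← Matrix.vecMul_add, ← hS]
        rw [Matrix.sub_vecMul, hYS]
        abel
    _ ≤ l + l ᵥ* S := add_le_add hlocal (vecMul_mono hS_nonneg hlocal)

theorem isCompact_flowPolytope (hmem : ∀ i, w i ∈ strictlyTriangular b)
    (hnonneg : ∀ i v u, 0 ≤ w i v u) : IsCompact (flowPolytope w l) := by
  obtain ⟨B, hB⟩ := exists_forall_mem_flowPolytope_sum_le hmem hnonneg l
  have hclosed : IsClosed (flowPolytope w l) := by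
    have hinter : flowPolytope w l = {y | netFlow w y = l} ∩ Set.Ici 0 :=
      Set.ext fun _ => mem_flowPolytope
    rw [hinter]
    exact (isClosed_eq (netFlow w).continuous_of_finiteDimensional continuous_const).inter
      isClosed_Ici
  refine (isCompact_Icc (a := 0) (b := fun _ => B)).of_isClosed_subset hclosed fun y hy => ?_
  have hy_nonneg := (mem_flowPolytope.1 hy).2
  exact ⟨hy_nonneg, fun i => (Finset.single_le_sum (fun i _ => hy_nonneg i)
    (Finset.mem_univ i)).trans (hB y hy)⟩

end Flow

theorem exists_isPolytope_supportFn_eq_dotProduct {ι V : Type*} [Finite ι] [Nonempty ι] [Fintype V]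
    {w : ι → Matrix V V ℝ} {l : V → ℝ} {b : V → ℕ} {d : ℕ}
    (hmem : ∀ i, w i ∈ strictlyTriangular b) (hnonneg : ∀ i v u, 0 ≤ w i v u) (hl : 0 ≤ l)
    (a : ι → Matrix V (Fin d) ℝ) :
    ∃ R : Set (Fin d → ℝ), IsPolytope R ∧ xc R ≤ Nat.card ι * Nat.card V ∧
      ∀ c p, SolvesMaxSystem w (fun i => a i *ᵥ c) p → supportFn R c = l ⬝ᵥ p := by
  have := Fintype.ofFinite ι
  let f : (ι → V → ℝ) →ₗ[ℝ] Fin d → ℝ := ∑ i, (a i).vecMulLinear ∘ₗ LinearMap.proj i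
  have hf (c : Fin d → ℝ) (y : ι → V → ℝ) : c ⬝ᵥ f y = ∑ i, y i ⬝ᵥ a i *ᵥ c := by
    simp [f, sum_dotProduct, dotProduct_comm c, Matrix.dotProduct_mulVec]
  obtain ⟨y, hy, -⟩ :=
    exists_mem_flowPolytope_supported hmem hnonneg hl fun _ => Classical.arbitrary ι
  have hcompact : IsCompact (flowPolytope w l) := isCompact_flowPolytope hmem hnonneg
  refine ⟨f '' flowPolytope w l, isPolytope_image_flatPolyhedron hcompact ⟨y, hy⟩ f, ?_,
    fun c p hp => ?_⟩
  · exact_mod_cast Nat.card_prod ι V ▸ xc_image_flatPolyhedron_le hcompact ⟨y, hy⟩ f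
  · rw [supportFn, Set.image_image]
    simp only [hf]
    exact (hp.isGreatest_image_flowPolytope hmem hnonneg hl).csSup_eq

/-! ### Maxout networks -/

namespace MaxoutNetwork

variable {k d s : ℕ} (N : MaxoutNetwork k d s)

/-- The number of neurons from which `v` can be reached, used as a layering of the network. -/
noncomputable def depth (v : Fin d ⊕ Fin s) : ℕ :=
  {u | Relation.TransGen N.Arc u v}.ncard

theorem depth_lt_depth_of_arc {u v : Fin d ⊕ Fin s} (h : N.Arc u v) : N.depth u < N.depth v :=
  Set.ncard_lt_ncard
    ⟨fun _ ht => ht.tail h, fun hsub => N.acyclic u (hsub (Relation.TransGen.single h))⟩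

open Classical in
/-- The `i`-th weights of the arcs into maxout units, extended by zero to pairs that are not
arcs. Rows are heads of arcs. -/
noncomputable def arcWeight (i : Fin k) : Matrix (Fin s) (Fin d ⊕ Fin s) ℝ :=
  Matrix.of fun v u => if N.Arc u (Sum.inr v) then N.weight i u (Sum.inr v) else 0

theorem toCols₂_arcWeight_mem_strictlyTriangular (i : Fin k) :
    (N.arcWeight i).toCols₂ ∈ strictlyTriangular fun v => N.depth (Sum.inr v) :=
  fun _ _ h => N.depth_lt_depth_of_arc (by_contra fun hvu => h (if_neg hvu))

theorem value_inr_eq_iSup_mulVec (x : Fin d → ℝ) (v : Fin s) :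
    N.value x (Sum.inr v) = ⨆ i, (N.arcWeight i *ᵥ N.value x) v := by
  classical
  rw [value_inr]
  refine iSup_congr fun i => ?_
  simp only [Matrix.mulVec, dotProduct, arcWeight, Matrix.of_apply, ite_mul, zero_mul]
  rw [← Finset.sum_filter]
  exact (Finset.sum_subtype (Finset.univ.filter fun u => N.Arc u (Sum.inr v)) (by simp)
    fun u => N.weight i u (Sum.inr v) * N.value x u).symm

theorem solvesMaxSystem_value [NeZero k] (x : Fin d → ℝ) :
    SolvesMaxSystem (fun i => (N.arcWeight i).toCols₂) (fun i => (N.arcWeight i).toCols₁ *ᵥ x)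
      fun v => N.value x (Sum.inr v) := by
  intro v
  have hrow (i : Fin k) : ((N.arcWeight i).toCols₂ *ᵥ (fun v => N.value x (Sum.inr v)) +
      (N.arcWeight i).toCols₁ *ᵥ x) v = (N.arcWeight i *ᵥ N.value x) v := by
    conv_rhs => rw [← Matrix.fromCols_toCols (N.arcWeight i), Matrix.fromCols_mulVec]
    simp [Function.comp_def, value_inl, add_comm]
  constructor
  · obtain ⟨i, hi⟩ := exists_eq_ciSup_of_finite (f := fun i => (N.arcWeight i *ᵥ N.value x) v)
    exact ⟨i, (hrow i).trans (hi.trans (N.value_inr_eq_iSup_mulVec x v).symm)⟩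
  · rintro _ ⟨i, rfl⟩
    exact ((hrow i).trans_le (le_ciSup (f := fun i => (N.arcWeight i *ᵥ N.value x) v)
      (Set.finite_range _).bddAbove i)).trans_eq (N.value_inr_eq_iSup_mulVec x v).symm

theorem exists_isPolytope_toFun_add_supportFn [NeZero k] :
    ∃ Q R : Set (Fin d → ℝ), IsPolytope Q ∧ IsPolytope R ∧ xc Q ≤ k * s ∧ xc R ≤ k * s ∧
      N.toFun + supportFn Q = supportFn R := by
  obtain ⟨M, w, hM, hw_mem, hw, hsolve⟩ :=
    exists_nonneg_weights _ N.toCols₂_arcWeight_mem_strictlyTriangular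
  let a : Fin k → Matrix (Fin s) (Fin d) ℝ := fun i => (N.arcWeight i).toCols₁
  obtain ⟨Q, hQ, hxcQ, hsuppQ⟩ := exists_isPolytope_supportFn_eq_dotProduct hw_mem hw
    (l := M N.output) (hM N.output) a
  obtain ⟨R, hR, hxcR, hsuppR⟩ := exists_isPolytope_supportFn_eq_dotProduct hw_mem hw
    (l := Pi.single N.output 1) (Pi.single_nonneg.2 zero_le_one) a
  rw [Nat.card_fin, Nat.card_fin] at hxcQ hxcR
  refine ⟨Q, R, hQ, hR, hxcQ, hxcR, funext fun x => ?_⟩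
  obtain ⟨p, hpz, hp⟩ := hsolve _ _ (N.solvesMaxSystem_value x)
  rw [Pi.add_apply, hsuppQ x p hp, hsuppR x p hp, single_one_dotProduct]
  exact (congrFun hpz N.output).symm

end MaxoutNetwork

theorem mainTheorem1_general {k d s : ℕ} [NeZero k] {P : Set (Fin d → ℝ)} (hcompact : IsCompact P)
    (hconv : Convex ℝ P) (hne : P.Nonempty) (N : MaxoutNetwork k d s)
    (hN : N.toFun = supportFn P) : vxc P ≤ 2 * k * s := by
  obtain ⟨Q, R, hQ, hR, hxcQ, hxcR, hQR⟩ := N.exists_isPolytope_toFun_add_supportFn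
  have hsum : P + Q = R := by
    refine eq_of_supportFn_eq (hcompact.add hQ.isCompact) (hconv.add hQ.isPolyhedron.convex)
      (hne.add hQ.nonempty) hR.isCompact hR.isPolyhedron.convex hR.nonempty (funext fun c => ?_)
    rw [supportFn_add hcompact hne hQ.isCompact hQ.nonempty, ← hN, ← hQR, Pi.add_apply]
  calc vxc P ≤ xc Q + xc R := iInf_le_of_le Q <| iInf_le_of_le R <| iInf_le _ ⟨hQ, hR, hsum⟩
    _ ≤ k * s + k * s := add_le_add hxcQ hxcR
    _ = 2 * k * s := by ring

theorem mainTheorem1 {d : ℕ} (P : Set (Fin d → ℝ)) (hP : IsPolytope P) :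
    vxc P ≤ 4 * nnc P := by
  have hfour : (4 : ℕ∞) ≠ 0 := four_ne_zero
  simp only [nnc, ENat.mul_iInf_of_ne hfour, le_iInf_iff]
  intro s N hN
  exact (mainTheorem1_general hP.isCompact hP.isPolyhedron.convex hP.nonempty N hN).trans_eq
    (by norm_num)
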